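/- Let a power network with $N$ nodes be given by a finite simple undirected graph of lines on $\{1,\dots,N\}$ ($\mathbf N(k)$ denotes the set of neighbours of node $k$), a series admittance $y_{kl}=y_{lk}\in\mathbb C$ and a shunt admittance $y^{\mathrm{sh}}_{kl}=y^{\mathrm{sh}}_{lk}\in\mathbb C$ for every line $\{k,l\}$, and a shunt admittance $y^{\mathrm{sh}}_k\in\mathbb C$ for every node $k$. Its nodal admittance matrix $Y\in\mathbb C^{N\times N}$ has the entries $Y_{kk}=y^{\mathrm{sh}}_k+\sum_{i\in\mathbf N(k)}\bigl(y_{ki}+\tfrac12 y^{\mathrm{sh}}_{ki}\bigr)$, $Y_{kl}=-y_{kl}$ for $l\in\mathbf N(k)$, and $Y_{kl}=0$ otherwise. For a state $x=(p^{\mathrm G},q^{\mathrm G},v,\theta)\in\mathbb R^{4N}$ put $u_k=v_ke^{\mathrm i\theta_k}$, and for a load profile $\xi=(p^{\mathrm L},q^{\mathrm L})\in\mathbb R^{2N}$ let $$F_\xi(x)=\begin{bmatrix}p^{\mathrm G}-p^{\mathrm L}-\operatorname{Re}\{\operatorname{diag}(u)\overline{(Yu)}\}\\ q^{\mathrm G}-q^{\mathrm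 L}-\operatorname{Im}\{\operatorname{diag}(u)\overline{(Yu)}\}\end{bmatrix}\in\mathbb R^{2N}.$$ Let $h:\mathbb R^{4N}\to\mathbb R^I$ and $g:\mathbb R^{4N}\to\mathbb R^J$ be the operational constraint functions and $\mathcal X=\{x : h(x)=0,\ g(x)\le 0\}$. For a system of constraints $H(x)=0$, $g(x)\le 0$ with $H:\mathbb R^{n}\to\mathbb R^{m}$, the linear independence constraint qualification (LICQ) is said to hold at a feasible point $x$ if, with $\mathbf J(x)=\{j: g_j(x)=0\}$, the matrix obtained by stacking the Jacobian $\nabla H(x)$ and the rows $\nabla g_j(x)$, $j\in\mathbf J(x)$, has rank $m+|\mathbf J(x)|$. Let $r>2N$ be an integer. Assume that $h$ and $g$ are of class $C^r$ in a neighbourhood of every point of $\mathcal X$, and that the LICQ holds for the constraints $h(x)=0$, $g(x)\le0$ at every $x\in\mathcal X$. Let $\Xi\subseteq\mathbb R^{2N}$ be open and nonempty. Then for Lebesgue-almost every $\xi\in\Xi$ the following hold. (i) The LICQ for the constraints $F_\xi(x)=0$, $h(x)=0$, $g(x)\le0$ holds at every point $x$ that satisfies these constraints. (ii) For every continuously differentiable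 cost $f:\mathbb R^{4N}\to\mathbb R$ and every local minimizer $\hat x$ of $f$ subject to $F_\xi(x)=0$, $h(x)=0$, $g(x)\le0$, there are unique multipliers $\kappa\in\mathbb R^{2N}$, $\lambda\in\mathbb R^{I}$, $\mu\in\mathbb R^{J}$ with $\mu\ge0$ such that $$\nabla f(\hat x)+\kappa^{T}\nabla F_\xi(\hat x)+\lambda^{T}\nabla h(\hat x)+\mu^{T}\nabla g(\hat x)=0\quad\text{and}\quad \mu_j=0\ \text{ whenever } g_j(\hat x)\neq0 .$$ -/

import Mathlib

namespace ACOPF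

section Optimization

variable {ι κ σ : Type*}

/-- The Jacobian matrix of `f : ℝ^ι → ℝ^κ` at `x`; its rows are indexed by the components
of `f` and its columns by the variables. -/
noncomputable def jacobian [Fintype ι] [DecidableEq ι] [Fintype κ]
    (f : (ι → ℝ) → (κ → ℝ)) (x : ι → ℝ) : Matrix κ ι ℝ :=
  LinearMap.toMatrix' (fderiv ℝ f x : (ι → ℝ) →ₗ[ℝ] (κ → ℝ))

/-- The feasible set of the constraints `h x = 0`, `g x ≤ 0` (componentwise). -/
def feasibleSet (h : (ι → ℝ) → (κ → ℝ)) (g : (ι → ℝ) → (σ → ℝ)) : Set (ι → ℝ) :=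
  {x | h x = 0 ∧ g x ≤ 0}

/-- The indices of the inequality constraints that are active at `x`. -/
def activeSet (g : (ι → ℝ) → (σ → ℝ)) (x : ι → ℝ) : Set σ :=
  {j | g x j = 0}

/-- Linear independence constraint qualification for `h = 0`, `g ≤ 0` at a (feasible) point `x`:
the Jacobian of `h` stacked on the rows of the Jacobian of `g` that belong to active constraints
has rank (number of equality constraints) + (number of active inequality constraints). -/
def LICQ [Fintype ι] [DecidableEq ι] [Fintype κ] [Fintype σ]
    (h : (ι → ℝ) → (κ → ℝ)) (g : (ι → ℝ) → (σ → ℝ)) (x : ι → ℝ) : Prop :=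
  (Matrix.fromRows (jacobian h x)
      ((jacobian g x).submatrix (fun j : activeSet g x => (j : σ)) id)).rank
    = Fintype.card κ + (activeSet g x).ncard

/-- The Lagrangian `f x + λᵀ h x + μᵀ g x`. -/
def lagrangian [Fintype κ] [Fintype σ]
    (f : (ι → ℝ) → ℝ) (h : (ι → ℝ) → (κ → ℝ)) (g : (ι → ℝ) → (σ → ℝ))
    (lam : κ → ℝ) (mu : σ → ℝ) (x : ι → ℝ) : ℝ :=
  f x + lam ⬝ᵥ h x + mu ⬝ᵥ g x

/-- `(lam, mu)` are Karush-Kuhn-Tucker multipliers at the (feasible) point `x`: `mu ≥ 0`, the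
gradient of the Lagrangian in `x` vanishes, and `mu j = 0` for every inactive constraint `j`. -/
def IsKKTMultiplier [Fintype ι] [Fintype κ] [Fintype σ]
    (f : (ι → ℝ) → ℝ) (h : (ι → ℝ) → (κ → ℝ)) (g : (ι → ℝ) → (σ → ℝ))
    (x : ι → ℝ) (lam : κ → ℝ) (mu : σ → ℝ) : Prop :=
  0 ≤ mu ∧ fderiv ℝ (lagrangian f h g lam mu) x = 0 ∧ ∀ j, j ∉ activeSet g x → mu j = 0

end Optimization

/-- A power network with `N` nodes: an undirected graph of lines, each line a `Π`-model with a
series admittance and a shunt admittance (values at pairs that are not lines are never used),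
and a shunt admittance at every node. -/
structure Network (N : ℕ) where
  /-- Nodes `k` and `l` are adjacent when a line connects them. -/
  lines : SimpleGraph (Fin N)
  /-- Series admittance `y_{kl}` of the line `{k, l}`. -/
  series : Sym2 (Fin N) → ℂ
  /-- Shunt admittance of the line `{k, l}`. -/
  lineShunt : Sym2 (Fin N) → ℂ
  /-- Shunt admittance of the node `k`. -/
  nodeShunt : Fin N → ℂ

open Classical in
/-- The nodal admittance matrix `Y`. -/
noncomputable def Network.admittance {N : ℕ} (net : Network N) : Matrix (Fin N) (Fin N) ℂ :=
  Matrix.of fun k l =>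
    if k = l then
      net.nodeShunt k +
        ∑ i with net.lines.Adj k i, (net.series s(k, i) + (1 / 2) * net.lineShunt s(k, i))
    else if net.lines.Adj k l then -net.series s(k, l)
    else 0

/-- The state space `ℝ^{4N}` of `x = (p^G, q^G, v, θ)`: the four blocks are indexed by
`0, 1, 2, 3` in this order. -/
abbrev State (N : ℕ) : Type := Fin 4 × Fin N → ℝ

/-- The space `ℝ^{2N}` of load profiles `ξ = (p^L, q^L)`: block `0` is `p^L`, block `1` is
`q^L`. The power flow equations take values in the same space (active, reactive balance). -/
abbrev Load (N : ℕ) : Type := Fin 2 × Fin N → ℝ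

/-- The complex nodal voltages `u_k = v_k e^{jθ_k}`. -/
noncomputable def voltage {N : ℕ} (x : State N) (k : Fin N) : ℂ :=
  (x (2, k) : ℂ) * Complex.exp ((x (3, k) : ℂ) * Complex.I)

/-- The complex nodal powers `diag(u) (Y u)^*` injected into the network. -/
noncomputable def Network.injection {N : ℕ} (net : Network N) (x : State N) (k : Fin N) : ℂ :=
  voltage x k * (starRingEnd ℂ) (net.admittance.mulVec (voltage x) k)

/-- The AC power flow map for the load profile `ξ`:
`(p^G - p^L - Re (diag(u) (Y u)^*), q^G - q^L - Im (diag(u) (Y u)^*))`. -/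
noncomputable def Network.powerFlow {N : ℕ} (net : Network N) (ξ : Load N) (x : State N) :
    Fin 2 × Fin N → ℝ :=
  fun i => ![x (0, i.2) - ξ (0, i.2) - (net.injection x i.2).re,
    x (1, i.2) - ξ (1, i.2) - (net.injection x i.2).im] i.1

/-- All equality constraints of the AC OPF problem with load profile `ξ` and operational equality
constraints `h`: the power flow equations stacked on `h`. -/
noncomputable def Network.equality {N I : ℕ} (net : Network N) (h : State N → (Fin I → ℝ))
    (ξ : Load N) (x : State N) : (Fin 2 × Fin N) ⊕ Fin I → ℝ :=
  Sum.elim (net.powerFlow ξ x) (h x)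

end ACOPF

open Set Filter Topology MeasureTheory

universe u

/-! Load and generation enter the power balance additively. Hence (ξ, w) ↦ `solution` (ξ, w), with w
the voltage magnitudes and angles, is a smooth global change of coordinates on the state space, and
F_ξ = 0 is the slice with first coordinate ξ. In these coordinates the assumed LICQ makes the full
derivative of (h, active g) surjective, and the LICQ with F_ξ added follows once the partial
derivative in w is surjective. Parametric transversality (`ae_surjective_fderiv_comp_inr`), applied
to each of the finitely many possible active sets, gives this for almost every ξ. The multipliers
then come from the KKT theorem under LICQ (`LICQ.existsUnique_isKKTMultiplier`).

Transversality with only n + 1 derivatives, n = dim W = 2N, needs an economical Sard argument. Where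
the partial derivative has a fixed deficient rank, a functional annihilating its range can be chosen
smoothly and normalised along some parameter direction v. On a line parallel to v it becomes a
multiplier η with η ∘ dG = π on the critical set, π being the coordinate along the line. There π -
η·G equals π, and its derivative is controlled by (G, π - η ∘ dG), which vanishes on the critical
set. Morse's lemma (`flatPiece_induction`) cuts that set into countably many pieces of dimension at
most n along which this pair vanishes to order n. So π is Hölder of exponent n + 1 on each piece and
has a null image. Fubini over the lines parallel to v concludes. -/

/-! ### Charts of level sets and countable localization -/

theorem ContDiffAt.eventually_norm_fderiv_le {E F : Type*} [NormedAddCommGroup E]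
    [NormedSpace ℝ E] [NormedAddCommGroup F] [NormedSpace ℝ F] {f : E → F} {m : ℕ} {x : E}
    (hm : m ≠ 0) (hf : ContDiffAt ℝ m f x) :
    ∀ᶠ y in 𝓝 x, ‖fderiv ℝ f y‖ ≤ ‖fderiv ℝ f x‖ + 1 := by
  have hcont : ContinuousAt (fderiv ℝ f) x :=
    (hf.fderiv_right (m := 0) (by exact_mod_cast Nat.one_le_iff_ne_zero.2 hm)).continuousAt
  filter_upwards [hcont.norm.eventually_lt_const (lt_add_one _)] with y hy using hy.le

/-- Implicit function theorem, parametrized by the kernel of the derivative and shrunk until the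
chart has a bounded derivative, as the mean value estimates below require. The chart only has to
cover the level set near `x₀`. -/
theorem exists_levelSet_chart {E : Type*} [NormedAddCommGroup E] [NormedSpace ℝ E]
    [FiniteDimensional ℝ E] {u : E → ℝ} {m : ℕ} {x₀ : E} {U : Set E} (hm : m ≠ 0)
    (hu : ContDiffAt ℝ m u x₀) (h0 : fderiv ℝ u x₀ ≠ 0) (hU : U ∈ 𝓝 x₀) :
    ∃ (N : Submodule ℝ E) (ψ : N → E) (U₀ : Set N) (K : ℝ),
      Module.finrank ℝ N < Module.finrank ℝ E ∧ IsOpen U₀ ∧ ContDiffOn ℝ m ψ U₀ ∧ (∀ y ∈ U₀, ‖fderiv ℝ ψ y‖ ≤ K) ∧ MapsTo ψ U₀ U ∧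
      ∀ᶠ x in 𝓝 x₀, u x = u x₀ → ∃ y ∈ U₀, ψ y = x := by
  have : CompleteSpace E := FiniteDimensional.complete ℝ E
  have hm' : (m : WithTop ℕ∞) ≠ 0 := by exact_mod_cast hm
  have hs : HasStrictFDerivAt u (fderiv ℝ u x₀) x₀ := hu.hasStrictFDerivAt hm'
  have hr : (fderiv ℝ u x₀).range = ⊤ := by
    rw [LinearMap.range_eq_top]
    exact LinearMap.surjective (f := (fderiv ℝ u x₀ : E →ₗ[ℝ] ℝ))
      (fun h => h0 (ContinuousLinearMap.coe_injective h))
  have hc : (fderiv ℝ u x₀).ker.ClosedComplemented :=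
    Submodule.ClosedComplemented.of_finiteDimensional _
  let φ := hs.implicitFunctionDataOfComplemented u (fderiv ℝ u x₀) hr hc
  have hright : ContDiff ℝ m φ.rightFun := by
    change ContDiff ℝ m (fun x => Classical.choose hc (x - x₀))
    fun_prop
  have hsm := φ.contDiffAt_implicitFunction (n := m) hu hright.contDiffAt hm'
  let k₀ : (fderiv ℝ u x₀).ker := φ.rightFun x₀
  let ψ : (fderiv ℝ u x₀).ker → E := φ.implicitFunction (u x₀)
  have hψ : ContDiffAt ℝ m ψ k₀ :=
    ContDiffAt.comp (f := fun k : (fderiv ℝ u x₀).ker => (u x₀, k)) k₀ hsm (by fun_prop)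
  have hψ0 : ψ k₀ = x₀ := by
    have := φ.implicitFunction_apply_image
    exact this.self_of_nhds
  have e1 : ∀ᶠ k in 𝓝 k₀, ContDiffAt ℝ m ψ k := hψ.eventually (by simp)
  have e2 : ∀ᶠ k in 𝓝 k₀, ‖fderiv ℝ ψ k‖ ≤ ‖fderiv ℝ ψ k₀‖ + 1 :=
    hψ.eventually_norm_fderiv_le hm
  have e3 : ∀ᶠ k in 𝓝 k₀, ψ k ∈ U := by
    apply hψ.continuousAt
    rwa [hψ0]
  obtain ⟨U₀, hU₀, hU₀o, hk₀⟩ := eventually_nhds_iff.1 (e1.and (e2.and e3))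
  have hlt : Module.finrank ℝ (fderiv ℝ u x₀).ker < Module.finrank ℝ E :=
    Submodule.finrank_lt fun h => h0 (ContinuousLinearMap.coe_injective (LinearMap.ker_eq_top.1 h))
  refine ⟨_, ψ, U₀, ‖fderiv ℝ ψ k₀‖ + 1, hlt, hU₀o, fun k hk => (hU₀ k hk).1.contDiffWithinAt,
    fun k hk => (hU₀ k hk).2.1, fun k hk => (hU₀ k hk).2.2, ?_⟩
  have e4 : ∀ᶠ x in 𝓝 x₀, φ.rightFun x ∈ U₀ :=
    hright.continuous.continuousAt (hU₀o.mem_nhds hk₀)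
  filter_upwards [e4, φ.leftFun_eq_iff_implicitFunction] with x hx1 hx2 hx3
  exact ⟨_, hx1, hx2.1 hx3⟩

/-- Lindelöf: countably many of the given neighbourhoods already cover `A`. -/
theorem of_locally_of_sUnion {X : Type*} [TopologicalSpace X] [SecondCountableTopology X]
    {P : Set X → Prop}
    (hP : ∀ T : Set (Set X), T.Countable → (∀ s ∈ T, P s) → P (⋃₀ T)) {A : Set X}
    (h : ∀ x ∈ A, ∃ V ∈ 𝓝 x, P (A ∩ V)) : P A := by
  choose! V hV hPV using h
  obtain ⟨t, htA, htc, ht⟩ := TopologicalSpace.countable_cover_nhdsWithin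
    (f := V) (s := A) (fun x hx => mem_nhdsWithin_of_mem_nhds (hV x hx))
  have : A = ⋃₀ ((fun x => A ∩ V x) '' t) := by
    rw [sUnion_image, ← inter_iUnion₂]
    exact (inter_eq_left.2 ht).symm
  rw [this]
  refine hP _ (htc.image _) ?_
  rintro _ ⟨x, hx, rfl⟩
  exact hPV x (htA hx)

/-! ### Morse's lemma on flat pieces -/

/-- `ψ` parametrizes a part `ψ '' S` of `A` in such a way that `f ∘ ψ` vanishes to order `k`
along `S`, uniformly on the convex set `B ⊇ S`. -/
structure FlatPiece {E E' F : Type*} [NormedAddCommGroup E] [NormedSpace ℝ E]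
    [NormedAddCommGroup E'] [NormedSpace ℝ E'] [NormedAddCommGroup F]
    (k : ℕ) (f : E → F) (A U : Set E) (ψ : E' → E) (S B : Set E') (K : ℝ) : Prop where
  convex : Convex ℝ B
  subset : S ⊆ B
  differentiableAt : ∀ y ∈ B, DifferentiableAt ℝ ψ y
  norm_fderiv_le : ∀ y ∈ B, ‖fderiv ℝ ψ y‖ ≤ K
  mapsTo : MapsTo ψ B U
  mapsTo_base : MapsTo ψ S A
  flat : ∀ x ∈ S, ∀ y ∈ B, ‖f (ψ y)‖ ≤ K * ‖y - x‖ ^ k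

namespace FlatPiece

variable {E E' F : Type*} [NormedAddCommGroup E] [NormedSpace ℝ E]
    [NormedAddCommGroup E'] [NormedSpace ℝ E'] [NormedAddCommGroup F]
    {k : ℕ} {A U : Set E} {ψ : E' → E} {S B : Set E'} {K : ℝ}

/-- Mean value inequality on the segment from `x` to `y`, which stays in the convex set `B` although
it may leave `S`. Integrating a derivative that is flat of order `k` gains one order. -/
theorem norm_comp_sub_le {G : Type*} [NormedAddCommGroup G] [NormedSpace ℝ G]
    {f : E → F} {φ : E → G} {C : ℝ} (hC : 0 ≤ C)
    (hp : FlatPiece k f A U ψ S B K) (hφ : ∀ z ∈ U, DifferentiableAt ℝ φ z)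
    (hφf : ∀ z ∈ U, ‖fderiv ℝ φ z‖ ≤ C * ‖f z‖) {x y : E'} (hx : x ∈ S) (hy : y ∈ B) :
    ‖φ (ψ y) - φ (ψ x)‖ ≤ C * K * K * ‖y - x‖ ^ (k + 1) := by
  have hseg : segment ℝ x y ⊆ B := hp.convex.segment_subset (hp.subset hx) hy
  have hK : 0 ≤ K := (norm_nonneg _).trans (hp.norm_fderiv_le y hy)
  have := (convex_segment (𝕜 := ℝ) x y).norm_image_sub_le_of_norm_fderiv_le (𝕜 := ℝ)
    (f := φ ∘ ψ) (C := C * (K * ‖y - x‖ ^ k) * K)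
    (fun z hz => (hφ _ (hp.mapsTo (hseg hz))).comp z (hp.differentiableAt z (hseg hz)))
    (fun z hz => ?_) (left_mem_segment ℝ x y) (right_mem_segment ℝ x y)
  · simp only [Function.comp_apply] at this
    calc _ ≤ _ := this
      _ = _ := by ring
  · rw [fderiv_comp z (hφ _ (hp.mapsTo (hseg hz))) (hp.differentiableAt z (hseg hz))]
    refine (ContinuousLinearMap.opNorm_comp_le _ _).trans ?_
    have h1 := hp.flat x hx z (hseg hz)
    have h2 : ‖z - x‖ ≤ ‖y - x‖ := by
      obtain ⟨t, ht, rfl⟩ := (segment_eq_image' ℝ x y) ▸ hz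
      rw [add_sub_cancel_left, norm_smul, Real.norm_of_nonneg ht.1]
      exact mul_le_of_le_one_left (norm_nonneg _) ht.2
    have h3 := hp.norm_fderiv_le z (hseg hz)
    have h4 := hφf _ (hp.mapsTo (hseg hz))
    have h5 : ‖z - x‖ ^ k ≤ ‖y - x‖ ^ k := by gcongr
    have h6 : ‖fderiv ℝ φ (ψ z)‖ ≤ C * (K * ‖y - x‖ ^ k) :=
      h4.trans (by gcongr; exact h1.trans (by gcongr))
    gcongr

end FlatPiece

/-- A. P. Morse's lemma, as an induction principle. -/
theorem flatPiece_induction (k : ℕ) : ∀ {E F : Type u} [NormedAddCommGroup E] [NormedSpace ℝ E]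
    [FiniteDimensional ℝ E] [NormedAddCommGroup F] [NormedSpace ℝ F] {f : E → F} {A U : Set E}
    (_ : IsOpen U) (_ : A ⊆ U) (_ : ContDiffOn ℝ k f U) (_ : ∀ x ∈ A, f x = 0)
    {P : Set E → Prop} (_ : ∀ T : Set (Set E), T.Countable → (∀ s ∈ T, P s) → P (⋃₀ T))
    (_ : ∀ (E' : Type u) [NormedAddCommGroup E'] [NormedSpace ℝ E'] [FiniteDimensional ℝ E']
      (ψ : E' → E) (S B : Set E') (K : ℝ), Module.finrank ℝ E' ≤ Module.finrank ℝ E →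
      FlatPiece k f A U ψ S B K → P (ψ '' S)), P A := by
  induction k with
  | zero =>
    intro E F _ _ _ _ _ f A U hU hAU hf hfA P hP hpiece
    have : ProperSpace E := FiniteDimensional.proper_real E
    refine of_locally_of_sUnion hP fun x hx => ?_
    have hxU := hAU hx
    have e1 : ∀ᶠ y in 𝓝 x, ‖f y‖ < ‖f x‖ + 1 :=
      (hf.continuousOn.continuousAt (hU.mem_nhds hxU)).norm.eventually_lt_const (by linarith)
    obtain ⟨ε, hε, hball⟩ := Metric.mem_nhds_iff.1 (e1.and (hU.mem_nhds hxU))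
    refine ⟨Metric.ball x ε, Metric.ball_mem_nhds x hε, ?_⟩
    have := hpiece E id (A ∩ Metric.ball x ε) (Metric.ball x ε) (‖f x‖ + 1) le_rfl
      { convex := convex_ball x ε
        subset := inter_subset_right
        differentiableAt := fun y _ => differentiableAt_id
        norm_fderiv_le := fun y _ => by
          rw [fderiv_id]
          exact ContinuousLinearMap.norm_id_le.trans (by linarith [norm_nonneg (f x)])
        mapsTo := fun y hy => (hball hy).2
        mapsTo_base := fun y hy => hy.1
        flat := fun z _ y hy => by simpa using (hball hy).1.le }
    simpa using this
  | succ k ihk =>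
    intro E F _ _ _ _ _
    obtain ⟨d, hd⟩ : ∃ d, Module.finrank ℝ E = d := ⟨_, rfl⟩
    induction d using Nat.strong_induction_on generalizing E F with
    | _ d ihd =>
    intro f A U hU hAU hf hfA P hP hpiece
    have : ProperSpace E := FiniteDimensional.proper_real E
    have hfd : ∀ x ∈ U, ContDiffAt ℝ (k + 1 : ℕ) f x := fun x hx => hf.contDiffAt (hU.mem_nhds hx)
    have hdiff : ∀ x ∈ U, DifferentiableAt ℝ f x := fun x hx =>
      (hfd x hx).differentiableAt (by simp)
    -- Where the derivative vanishes, the case `k` applies to `fderiv ℝ f`, and integration raises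
    -- the order of flatness of `f` to `k + 1`.
    have hflat : P {x ∈ A | fderiv ℝ f x = 0} := by
      refine ihk (f := fderiv ℝ f) (U := U) hU (fun x hx => hAU hx.1) (fun x hx => ?_)
        (fun x hx => hx.2) hP fun E' _ _ _ ψ S B K hE' hp => ?_
      · exact ((hfd x hx).fderiv_right (by norm_cast)).contDiffWithinAt
      · refine hpiece E' ψ S B (max K (1 * K * K)) hE'
          { convex := hp.convex
            subset := hp.subset
            differentiableAt := hp.differentiableAt
            norm_fderiv_le := fun y hy => (hp.norm_fderiv_le y hy).trans (le_max_left _ _)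
            mapsTo := hp.mapsTo
            mapsTo_base := fun x hx => (hp.mapsTo_base hx).1
            flat := fun x hx y hy => ?_ }
        have := hp.norm_comp_sub_le zero_le_one hdiff (fun z _ => (one_mul _).ge) hx hy
        rw [hfA _ (hp.mapsTo_base hx).1, sub_zero] at this
        exact this.trans (by gcongr; exact le_max_right _ _)
    -- Elsewhere some scalar component `l ∘ f` is regular, so `A` lies locally in a hypersurface.
    -- Composing with its chart keeps the smoothness and lowers the dimension, and the inner
    -- induction applies.
    have hreg : P {x ∈ A | fderiv ℝ f x ≠ 0} := by
      refine of_locally_of_sUnion hP fun x hx => ?_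
      have hxU := hAU hx.1
      obtain ⟨v, hv⟩ : ∃ v, fderiv ℝ f x v ≠ 0 := by
        by_contra! h
        exact hx.2 (ContinuousLinearMap.ext h)
      obtain ⟨l, hl⟩ : ∃ l : F →L[ℝ] ℝ, l (fderiv ℝ f x v) ≠ 0 := by
        exact SeparatingDual.exists_ne_zero hv
      have hlf : fderiv ℝ (fun z => l (f z)) x = l.comp (fderiv ℝ f x) :=
        (l.hasFDerivAt.comp x (hdiff x hxU).hasFDerivAt).fderiv
      have hne : fderiv ℝ (fun z => l (f z)) x ≠ 0 := fun h => hl (by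
        have := DFunLike.congr_fun (hlf ▸ h) v
        simpa using this)
      obtain ⟨N, ψ, U₀, K, hlt, hU₀, hψ, hψK, hψU, hcov⟩ := exists_levelSet_chart
        (u := fun z => l (f z)) (m := k + 1) (by simp) (l.contDiff.contDiffAt.comp x (hfd x hxU)) hne (hU.mem_nhds hxU)
      refine ⟨_, hcov, ?_⟩
      set V := {z | l (f z) = l (f x) → ∃ y ∈ U₀, ψ y = z}
      have hset : {z ∈ A | fderiv ℝ f z ≠ 0} ∩ V =
          ψ '' (U₀ ∩ ψ ⁻¹' ({z ∈ A | fderiv ℝ f z ≠ 0} ∩ V)) := by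
        apply Subset.antisymm
        · rintro z ⟨hz, hzV⟩
          obtain ⟨y, hy, rfl⟩ := hzV (by rw [hfA z hz.1, hfA x hx.1])
          exact ⟨y, ⟨hy, hz, hzV⟩, rfl⟩
        · rintro _ ⟨y, hy, rfl⟩
          exact hy.2
      change P ({z ∈ A | fderiv ℝ f z ≠ 0} ∩ V)
      rw [hset]
      refine ihd _ (hd ▸ hlt) rfl (f := f ∘ ψ)
        (A := U₀ ∩ ψ ⁻¹' ({z ∈ A | fderiv ℝ f z ≠ 0} ∩ V)) (U := U₀)
        hU₀ inter_subset_left (hf.comp hψ hψU) (fun y hy => hfA _ hy.2.1.1)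
        (P := fun S => P (ψ '' S)) ?_ ?_
      · intro T hT hPT
        have : ψ '' ⋃₀ T = ⋃₀ ((fun s => ψ '' s) '' T) := by
          rw [sUnion_image, sUnion_eq_biUnion, image_iUnion₂]
        rw [this]
        refine hP _ (hT.image _) ?_
        rintro _ ⟨s, hs, rfl⟩
        exact hPT s hs
      · intro E' _ _ _ θ S B L hE' hp
        have hψd : ∀ y ∈ U₀, DifferentiableAt ℝ ψ y := fun y hy =>
          (hψ.contDiffAt (hU₀.mem_nhds hy)).differentiableAt (by simp)
        rw [← image_comp]
        refine hpiece E' (ψ ∘ θ) S B (max L (K * L)) (hE'.trans hlt.le)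
          { convex := hp.convex
            subset := hp.subset
            differentiableAt := fun y hy =>
              (hψd _ (hp.mapsTo hy)).comp y (hp.differentiableAt y hy)
            norm_fderiv_le := fun y hy => ?_
            mapsTo := hψU.comp hp.mapsTo
            mapsTo_base := fun y hy => (hp.mapsTo_base hy).2.1.1
            flat := fun x hx y hy => (hp.flat x hx y hy).trans
              (by gcongr; exact le_max_left _ _) }
        rw [fderiv_comp y (hψd _ (hp.mapsTo hy)) (hp.differentiableAt y hy)]
        refine (ContinuousLinearMap.opNorm_comp_le _ _).trans (le_trans ?_ (le_max_right _ _))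
        have h1 := hψK _ (hp.mapsTo hy)
        have h2 := hp.norm_fderiv_le y hy
        have h3 : 0 ≤ K := le_trans (norm_nonneg (fderiv ℝ ψ (θ y))) h1
        gcongr
    have : A = ⋃₀ {{x ∈ A | fderiv ℝ f x = 0}, {x ∈ A | fderiv ℝ f x ≠ 0}} := by
      ext x
      by_cases h : fderiv ℝ f x = 0 <;> simp [h]
    rw [this]
    refine hP _ (by simp) ?_
    rintro s (rfl | rfl)
    exacts [hflat, hreg]

/-! ### Null images by flatness -/

open scoped NNReal ENNReal in
-- A Hölder map of exponent n + 1 divides Hausdorff dimension by n + 1, so the image has dimension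
-- at most n / (n + 1) < 1.
theorem volume_image_eq_zero_of_abs_sub_le_pow {E : Type*} [NormedAddCommGroup E] [NormedSpace ℝ E]
    [FiniteDimensional ℝ E] {n : ℕ} (hn : Module.finrank ℝ E ≤ n) {g : E → ℝ} {S : Set E} {K : ℝ}
    (h : ∀ x ∈ S, ∀ y ∈ S, |g y - g x| ≤ K * ‖y - x‖ ^ (n + 1)) : volume (g '' S) = 0 := by
  have hh : HolderOnWith K.toNNReal ((n + 1 : ℕ) : ℝ≥0) g S := by
    intro x hx y hy
    have h1 := h y hy x hx
    rw [edist_dist, edist_dist, NNReal.coe_natCast, ENNReal.rpow_natCast,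
      ← ENNReal.ofReal_pow dist_nonneg, ← ENNReal.ofReal, ← ENNReal.ofReal_mul' (by positivity),
      Real.dist_eq, dist_eq_norm]
    exact ENNReal.ofReal_le_ofReal h1
  have hd := hh.dimH_image_le (by positivity)
  have hS : dimH S ≤ n := by
    refine (dimH_mono (subset_univ S)).trans ?_
    rw [Real.dimH_univ_eq_finrank]
    exact_mod_cast hn
  have hlt : dimH (g '' S) < (1 : ℝ≥0) := by
    refine hd.trans_lt ?_
    rw [ENNReal.div_lt_iff (by simp) (by simp)]
    refine hS.trans_lt ?_
    simp only [ENNReal.coe_natCast, ENNReal.coe_one, one_mul]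
    exact_mod_cast Nat.lt_succ_self n
  have := hausdorffMeasure_of_dimH_lt hlt
  rwa [NNReal.coe_one, hausdorffMeasure_real] at this

/-- A sharp-smoothness version of Sard's theorem (up to one derivative) for the linear functional
`π` on the zero set of `G`, whose critical points are described by smooth multipliers `η`. -/
theorem volume_image_eq_zero_of_multiplier {E C : Type u} [NormedAddCommGroup E] [NormedSpace ℝ E]
    [FiniteDimensional ℝ E] [NormedAddCommGroup C] [NormedSpace ℝ C] {n : ℕ}
    (hE : Module.finrank ℝ E ≤ n + 1) (hn : n ≠ 0) {G : E → C} {η : E → C →L[ℝ] ℝ}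
    {π : E →L[ℝ] ℝ} (hπ : π ≠ 0) {A U : Set E} (hU : IsOpen U) (hAU : A ⊆ U)
    (hG : ContDiffOn ℝ (n + 1 : ℕ) G U) (hη : ContDiffOn ℝ n η U) {M : ℝ}
    (hM : ∀ x ∈ U, ‖fderiv ℝ η x‖ ≤ M) (hGA : ∀ x ∈ A, G x = 0)
    (hA : ∀ x ∈ A, (η x).comp (fderiv ℝ G x) = π) : volume (π '' A) = 0 := by
  have : ProperSpace E := FiniteDimensional.proper_real E
  have hGd : ∀ x ∈ U, ContDiffAt ℝ (n + 1 : ℕ) G x := fun x hx => hG.contDiffAt (hU.mem_nhds hx)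
  have hG' : ∀ x ∈ U, HasFDerivAt G (fderiv ℝ G x) x := fun x hx =>
    ((hGd x hx).differentiableAt (by simp)).hasFDerivAt
  have hη' : ∀ x ∈ U, HasFDerivAt η (fderiv ℝ η x) x := fun x hx =>
    ((hη.contDiffAt (hU.mem_nhds hx)).differentiableAt (by simpa using hn)).hasFDerivAt
  have hunion : ∀ {X : Type u} (g : X → ℝ) (T : Set (Set X)), T.Countable →
      (∀ s ∈ T, volume (g '' s) = 0) → volume (g '' ⋃₀ T) = 0 := by
    intro X g T hT h
    rw [sUnion_eq_biUnion, image_iUnion₂]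
    exact (measure_biUnion_null_iff hT).2 h
  refine of_locally_of_sUnion (P := fun S => volume (π '' S) = 0) (hunion π) fun x₀ hx₀ => ?_
  have hx₀U := hAU hx₀
  have hder : fderiv ℝ (fun z => η x₀ (G z)) x₀ = π := by
    rw [← hA x₀ hx₀]
    exact ((η x₀).hasFDerivAt.comp x₀ (hG' x₀ hx₀U)).fderiv
  -- Freezing the multiplier at `x₀` gives a function vanishing on `A` with derivative `π ≠ 0` at
  -- `x₀`. Passing to its level set brings the dimension down to at most n, which the exponent n + 1
  -- can beat.
  obtain ⟨N, ψ, U₀, K, hlt, hU₀, hψ, hψK, hψU, hcov⟩ := exists_levelSet_chart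
    (u := fun z => η x₀ (G z)) (m := n + 1) (by simp)
    ((η x₀).contDiff.contDiffAt.comp x₀ (hGd x₀ hx₀U)) (hder ▸ hπ) (hU.mem_nhds hx₀U)
  refine ⟨_, hcov, ?_⟩
  set V := {z | η x₀ (G z) = η x₀ (G x₀) → ∃ y ∈ U₀, ψ y = z}
  have hset : A ∩ V = ψ '' (U₀ ∩ ψ ⁻¹' (A ∩ V)) := by
    apply Subset.antisymm
    · rintro z ⟨hz, hzV⟩
      obtain ⟨y, hy, rfl⟩ := hzV (by rw [hGA z hz, hGA x₀ hx₀])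
      exact ⟨y, ⟨hy, hz, hzV⟩, rfl⟩
    · rintro _ ⟨y, hy, rfl⟩
      exact hy.2
  rw [hset, ← image_comp]
  -- Both components vanish on `A`. The second contains `fderiv ℝ G`, so n + 1 derivatives of `G`
  -- leave n for `f`.
  let f : E → C × (E →L[ℝ] ℝ) := fun z => (G z, π - (η z).comp (fderiv ℝ G z))
  have hf : ContDiffOn ℝ n f U := by
    intro x hx
    have h1 : ContDiffAt ℝ n G x := (hGd x hx).of_le (by norm_cast; omega)
    have h2 : ContDiffAt ℝ n (fderiv ℝ G) x := (hGd x hx).fderiv_right (by norm_cast)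
    have h3 : ContDiffAt ℝ n η x := hη.contDiffAt (hU.mem_nhds hx)
    exact (h1.prodMk (contDiffAt_const.sub (h3.clm_comp h2))).contDiffWithinAt
  -- `Φ` equals `π` on `A`, and its derivative is the second component of `f` minus a term linear in
  -- `G`, hence bounded by `f`.
  let Φ : E → ℝ := fun z => π z - η z (G z)
  have hΦ : ∀ z ∈ U, HasFDerivAt Φ
      (π - ((η z).comp (fderiv ℝ G z) + (fderiv ℝ η z).flip (G z))) z := fun z hz =>
    π.hasFDerivAt.sub ((hη' z hz).clm_apply (hG' z hz))
  have hΦn : ∀ z ∈ U, ‖fderiv ℝ Φ z‖ ≤ (1 + M) * ‖f z‖ := by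
    intro z hz
    rw [(hΦ z hz).fderiv, ← sub_sub, add_mul, one_mul]
    refine (norm_sub_le _ _).trans (add_le_add (norm_snd_le (f z)) ?_)
    refine ((fderiv ℝ η z).flip.le_opNorm _).trans ?_
    rw [ContinuousLinearMap.opNorm_flip]
    have h1 := hM z hz
    have h2 : ‖G z‖ ≤ ‖f z‖ := norm_fst_le (f z)
    have h3 : 0 ≤ M := le_trans (norm_nonneg (fderiv ℝ η z)) h1
    gcongr
  have hM0 : 0 ≤ M := le_trans (norm_nonneg (fderiv ℝ η x₀)) (hM x₀ hx₀U)
  have hψd : ∀ y ∈ U₀, DifferentiableAt ℝ ψ y := fun y hy =>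
    (hψ.contDiffAt (hU₀.mem_nhds hy)).differentiableAt (by simp)
  have hΦψ : ∀ y ∈ U₀, DifferentiableAt ℝ (Φ ∘ ψ) y := fun y hy =>
    (hΦ _ (hψU hy)).differentiableAt.comp y (hψd y hy)
  have hΦψn : ∀ y ∈ U₀, ‖fderiv ℝ (Φ ∘ ψ) y‖ ≤ ((1 + M) * |K|) * ‖(f ∘ ψ) y‖ := by
    intro y hy
    rw [fderiv_comp y (hΦ _ (hψU hy)).differentiableAt (hψd y hy)]
    refine (ContinuousLinearMap.opNorm_comp_le _ _).trans ?_
    have h1 := hΦn _ (hψU hy)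
    have h2 : ‖fderiv ℝ ψ y‖ ≤ |K| := (hψK y hy).trans (le_abs_self K)
    calc _ ≤ ((1 + M) * ‖f (ψ y)‖) * |K| := by gcongr
      _ = _ := by simp only [Function.comp_apply]; ring
  refine flatPiece_induction n (f := f ∘ ψ) (U := U₀) (A := U₀ ∩ ψ ⁻¹' (A ∩ V)) hU₀
    inter_subset_left (hf.comp (hψ.of_le (by norm_cast; omega)) hψU) ?_
    (P := fun S => volume ((π ∘ ψ) '' S) = 0) (hunion _) ?_
  · intro y hy
    simp [f, hGA _ hy.2.1, hA _ hy.2.1]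
  · intro E' _ _ _ θ S B L hE' hp
    rw [← image_comp]
    refine volume_image_eq_zero_of_abs_sub_le_pow (n := n) (by omega)
      (K := (1 + M) * |K| * L * L) fun x hx y hy => ?_
    have := hp.norm_comp_sub_le (by positivity) hΦψ hΦψn hx (hp.subset hy)
    have e : ∀ z ∈ S, (Φ ∘ ψ) (θ z) = π (ψ (θ z)) := fun z hz => by
      simp [Φ, hGA _ (hp.mapsTo_base hz).2.1]
    rwa [e x hx, e y hy, Real.norm_eq_abs] at this

/-! ### Parametric transversality -/

/-- Near a non-surjective `T₀`, operators of the same rank as `T₀` have a nonzero functional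
annihilating their range that depends smoothly on the operator. -/
theorem exists_contDiffAt_annihilator {W C : Type*} [NormedAddCommGroup W] [NormedSpace ℝ W]
    [FiniteDimensional ℝ W] [NormedAddCommGroup C] [NormedSpace ℝ C] [FiniteDimensional ℝ C]
    {T₀ : W →L[ℝ] C} (hT₀ : ¬ Function.Surjective T₀) (n : ℕ) :
    ∃ η : (W →L[ℝ] C) → (C →L[ℝ] ℝ), ContDiffAt ℝ n η T₀ ∧ η T₀ ≠ 0 ∧
      ∀ᶠ T in 𝓝 T₀, Module.finrank ℝ T.range = Module.finrank ℝ T₀.range → (η T).comp T = 0 := by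
  obtain ⟨K, hK⟩ := T₀.ker.exists_isCompl
  obtain ⟨M, hM⟩ := T₀.range.exists_isCompl
  have hMne : M ≠ ⊥ := by
    rintro rfl
    exact hT₀ (LinearMap.range_eq_top.1 (by simpa using hM.sup_eq_top))
  obtain ⟨m, hmM, hm0⟩ := M.exists_mem_ne_zero_of_ne_bot hMne
  obtain ⟨l, hl⟩ : ∃ l : M →L[ℝ] ℝ, l ⟨m, hmM⟩ ≠ 0 :=
    SeparatingDual.exists_ne_zero (by simpa using hm0)
  -- `L T₀` is an isomorphism because `K` complements the kernel and `M` the range. It stays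
  -- invertible near `T₀`, with a smoothly varying inverse. Reading off the `M` component of the
  -- inverse and applying `l` gives `η`.
  let L : (W →L[ℝ] C) → (K × M →L[ℝ] C) := fun T =>
    (T.comp K.subtypeL).comp (ContinuousLinearMap.fst ℝ K M) +
      M.subtypeL.comp (ContinuousLinearMap.snd ℝ K M)
  have hL : ∀ T k m, L T (k, m) = T k + m := fun T k m => rfl
  have hLs : ContDiff ℝ n L :=
    ((contDiff_id.clm_comp contDiff_const).clm_comp contDiff_const).add contDiff_const
  have hbij : Function.Bijective (L T₀) := by
    constructor
    · refine (injective_iff_map_eq_zero _).2 ?_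
      rintro ⟨k, m⟩ h
      rw [hL] at h
      have h1 : T₀ k = 0 := by
        have : T₀ k ∈ T₀.range ⊓ M :=
          ⟨⟨k, rfl⟩, by rw [eq_neg_of_add_eq_zero_left h]; exact M.neg_mem m.2⟩
        rwa [hM.inf_eq_bot, Submodule.mem_bot] at this
      have h2 : (k : W) = 0 := by
        have : (k : W) ∈ T₀.ker ⊓ K := ⟨h1, k.2⟩
        rwa [hK.inf_eq_bot, Submodule.mem_bot] at this
      rw [h1, zero_add] at h
      exact Prod.ext (Subtype.ext h2) (Subtype.ext h)
    · intro c
      obtain ⟨_, ⟨w, rfl⟩, m, hm, rfl⟩ := Submodule.mem_sup.1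
        (hM.sup_eq_top ▸ Submodule.mem_top : c ∈ T₀.range ⊔ M)
      obtain ⟨k', hk', k, hk, rfl⟩ := Submodule.mem_sup.1
        (hK.sup_eq_top ▸ Submodule.mem_top : w ∈ T₀.ker ⊔ K)
      refine ⟨(⟨k, hk⟩, ⟨m, hm⟩), ?_⟩
      have : T₀ k' = 0 := hk'
      simp [hL, this]
  let e : (K × M) ≃L[ℝ] C :=
    (LinearEquiv.ofBijective (L T₀ : K × M →ₗ[ℝ] C) hbij).toContinuousLinearEquiv
  have he : (e : K × M →L[ℝ] C) = L T₀ := by ext <;> rfl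
  have hKfin : Module.finrank ℝ K = Module.finrank ℝ T₀.range := by
    have h1 := Submodule.finrank_add_eq_of_isCompl hK
    have h2 := LinearMap.finrank_range_add_finrank_ker (T₀ : W →ₗ[ℝ] C)
    omega
  refine ⟨fun T => (l.comp (ContinuousLinearMap.snd ℝ K M)).comp
    (ContinuousLinearMap.inverse (L T)), ?_, ?_, ?_⟩
  · refine contDiffAt_const.clm_comp ?_
    refine ContDiffAt.comp (g := ContinuousLinearMap.inverse) T₀ ?_ hLs.contDiffAt
    rw [← he]
    exact contDiffAt_map_inverse e
  · intro h
    beta_reduce at h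
    have h1 := DFunLike.congr_fun h m
    rw [← he, ContinuousLinearMap.inverse_equiv] at h1
    have h2 : e.symm m = (0, ⟨m, hmM⟩) := by
      rw [ContinuousLinearEquiv.symm_apply_eq]
      change m = L T₀ (0, ⟨m, hmM⟩)
      simp [hL]
    simp only [ContinuousLinearMap.comp_apply, ContinuousLinearEquiv.coe_coe, h2] at h1
    exact hl h1
  · have hn : L ⁻¹' range ((↑) : ((K × M) ≃L[ℝ] C) → (K × M →L[ℝ] C)) ∈ 𝓝 T₀ := by
      refine hLs.continuous.continuousAt ?_
      rw [← he]
      exact ContinuousLinearEquiv.nhds e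
    filter_upwards [hn] with T ⟨e', he'⟩ hrank
    rw [← he', ContinuousLinearMap.inverse_equiv]
    have hk : ∀ k : K, e' (k, 0) = T k := fun k => by
      have := DFunLike.congr_fun he' (k, 0)
      simpa [hL] using this
    -- Equality of ranks forces the range of `T` to be `T K`, on which the `M` component vanishes.
    have hmap : K.map (T : W →ₗ[ℝ] C) = T.range := by
      refine Submodule.eq_of_le_of_finrank_eq LinearMap.map_le_range ?_
      rw [hrank, ← hKfin]
      have hinj : Function.Injective ((T : W →ₗ[ℝ] C).domRestrict K) := fun a b hab => by
        have hab' : e' (a, 0) = e' (b, 0) := by rw [hk, hk]; exact hab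
        exact (Prod.ext_iff.1 (e'.injective hab')).1
      have := LinearMap.finrank_range_of_inj hinj
      rwa [LinearMap.range_domRestrict] at this
    ext w
    obtain ⟨k, hkK, hkw⟩ : T w ∈ K.map (T : W →ₗ[ℝ] C) := hmap ▸ ⟨w, rfl⟩
    have h2 : e'.symm (T w) = (⟨k, hkK⟩, 0) := by
      rw [ContinuousLinearEquiv.symm_apply_eq, hk]
      exact hkw.symm
    simp [h2]

section ParametricTransversality

variable {P W C : Type u} [NormedAddCommGroup P] [NormedSpace ℝ P] [FiniteDimensional ℝ P]
  [MeasurableSpace P] [BorelSpace P] [NormedAddCommGroup W] [NormedSpace ℝ W]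
  [FiniteDimensional ℝ W] [NormedAddCommGroup C] [NormedSpace ℝ C] [FiniteDimensional ℝ C]

/-- Near `z₀` the stratum of constant rank lies in a compact set described by a smooth multiplier.
Every line in one fixed parameter direction meets the projection of that set in a null set, so
Fubini applies. -/
theorem exists_nhds_measure_critical_eq_zero (μ : Measure P) [μ.IsAddHaarMeasure] {n : ℕ}
    (hW : Module.finrank ℝ W ≤ n) (hn : n ≠ 0) {H : P × W → C} {z₀ : P × W}
    (hH : ContDiffAt ℝ (n + 1 : ℕ) H z₀) (hsurj : Function.Surjective (fderiv ℝ H z₀))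
    (hns : ¬ Function.Surjective ((fderiv ℝ H z₀).comp (ContinuousLinearMap.inr ℝ P W))) :
    ∃ V ∈ 𝓝 z₀, μ (Prod.fst '' {z ∈ V | H z = 0 ∧
      Module.finrank ℝ ((fderiv ℝ H z).comp (ContinuousLinearMap.inr ℝ P W)).range =
      Module.finrank ℝ ((fderiv ℝ H z₀).comp (ContinuousLinearMap.inr ℝ P W)).range}) = 0 := by
  have : ProperSpace (P × W) := FiniteDimensional.proper_real _
  have : ProperSpace P := FiniteDimensional.proper_real _
  set T : P × W → (W →L[ℝ] C) := fun z => (fderiv ℝ H z).comp (ContinuousLinearMap.inr ℝ P W)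
    with hTdef
  obtain ⟨η, hηs, hη0, hηT⟩ := exists_contDiffAt_annihilator hns n
  have hdH : ContDiffAt ℝ n (fderiv ℝ H) z₀ := hH.fderiv_right (by norm_cast)
  have hTs : ContDiffAt ℝ n T z₀ := hdH.clm_comp contDiffAt_const
  have hηTs : ContDiffAt ℝ n (fun z => η (T z)) z₀ := ContDiffAt.comp z₀ hηs hTs
  -- The functional `η (T z₀)` kills the `W` directions. As it is nonzero and the full derivative is
  -- onto, it must detect some parameter direction.
  obtain ⟨v, hv⟩ : ∃ v : P, η (T z₀) (fderiv ℝ H z₀ (v, 0)) ≠ 0 := by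
    by_contra! h
    refine hη0 (ContinuousLinearMap.ext fun c => ?_)
    obtain ⟨⟨a, b⟩, rfl⟩ := hsurj c
    have h1 : (a, b) = (a, 0) + ContinuousLinearMap.inr ℝ P W b := by simp
    have h2 := DFunLike.congr_fun (hηT.self_of_nhds rfl) b
    rw [h1, map_add, map_add]
    have h3 := h a
    simp only [ContinuousLinearMap.comp_apply] at h2
    exact (congrArg₂ (· + ·) h3 h2).trans (by simp)
  let s : P × W → ℝ := fun z => η (T z) (fderiv ℝ H z (v, 0))
  have hss : ContDiffAt ℝ n s z₀ := hηTs.clm_apply (hdH.clm_apply contDiffAt_const)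
  let ζ : P × W → (C →L[ℝ] ℝ) := fun z => (s z)⁻¹ • η (T z)
  have hζ : ContDiffAt ℝ n ζ z₀ := (hss.inv hv).smul hηTs
  have hev := (hH.eventually (by simp)).and ((hζ.eventually (by simp)).and
    ((hζ.eventually_norm_fderiv_le hn).and ((hss.continuousAt.eventually_ne hv).and
      (hTs.continuousAt.eventually hηT))))
  obtain ⟨ε, hε, hball⟩ := Metric.mem_nhds_iff.1 hev
  set V := Metric.closedBall z₀ (ε / 2)
  have hVb : V ⊆ Metric.ball z₀ ε := Metric.closedBall_subset_ball (by linarith)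
  have hTV : ContinuousOn T V := fun z hz =>
    (((hball (hVb hz)).1.fderiv_right (m := n) (by norm_cast)).clm_comp
      contDiffAt_const).continuousAt.continuousWithinAt
  -- The rank condition is relaxed to the closed condition that `ζ` annihilates `T`. Then `D` is
  -- compact, so its projection is measurable.
  let D := {z ∈ V | (H z, (ζ z).comp (T z)) ∈ ({0} : Set (C × (W →L[ℝ] ℝ)))}
  have hD : IsCompact D := by
    refine (isCompact_closedBall z₀ (ε / 2)).of_isClosed_subset ?_ (fun z hz => hz.1)
    refine ContinuousOn.preimage_isClosed_of_isClosed (f := fun z => (H z, (ζ z).comp (T z)))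
      (s := V) (ContinuousOn.prodMk ?_ (ContinuousOn.clm_comp ?_ hTV)) Metric.isClosed_closedBall
      isClosed_singleton
    · exact fun z hz => (hball (hVb hz)).1.continuousAt.continuousWithinAt
    · exact fun z hz => (hball (hVb hz)).2.1.continuousAt.continuousWithinAt
  refine ⟨V, Metric.closedBall_mem_nhds _ (by linarith), ?_⟩
  refine measure_mono_null (t := Prod.fst '' D) (image_mono ?_) ?_
  · rintro z ⟨hzV, hz0, hzr⟩
    refine ⟨hzV, Prod.ext hz0 ?_⟩
    have := (hball (hVb hzV)).2.2.2.2 hzr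
    change ((s z)⁻¹ • η (T z)).comp (T z) = 0
    rw [ContinuousLinearMap.smul_comp, this, smul_zero]
  have hmeas : MeasurableSet (Prod.fst '' D)ᶜ := (hD.image continuous_fst).measurableSet.compl
  have := ae_mem_of_ae_add_linearMap_mem (LinearMap.toSpanSingleton ℝ P v) volume μ hmeas
    (fun y => ?_)
  · simpa only [ae_iff, mem_compl_iff, not_not, Set.ofPred_mem_eq] using this
  rw [ae_iff]
  -- Restriction to the parameter line through `y` in direction `v`. The normalisation of `ζ` makes
  -- it a multiplier for the line coordinate.
  let a : ℝ × W → P × W := fun x => (y + x.1 • v, x.2)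
  let A' : ℝ × W →L[ℝ] P × W :=
    ((ContinuousLinearMap.fst ℝ ℝ W).smulRight v).prod (ContinuousLinearMap.snd ℝ ℝ W)
  have ha : ContDiff ℝ (n + 1 : ℕ) a := by fun_prop
  have ha' : ∀ x, HasFDerivAt a A' x := fun x =>
    (((ContinuousLinearMap.fst ℝ ℝ W).hasFDerivAt.smul_const v).const_add y).prodMk
      (ContinuousLinearMap.snd ℝ ℝ W).hasFDerivAt
  have key := volume_image_eq_zero_of_multiplier (E := ℝ × W) (C := C) (n := n)
    (by rw [Module.finrank_prod, Module.finrank_self]; omega) hn (G := H ∘ a) (η := ζ ∘ a)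
    (π := ContinuousLinearMap.fst ℝ ℝ W) (A := a ⁻¹' D) (U := a ⁻¹' Metric.ball z₀ ε)
    (M := (‖fderiv ℝ ζ z₀‖ + 1) * ‖A'‖)
    (fun h => by simpa using DFunLike.congr_fun h ((1 : ℝ), (0 : W)))
    (Metric.isOpen_ball.preimage ha.continuous) (fun x hx => hVb hx.1)
    (fun x hx => ((hball hx).1.comp x ha.contDiffAt).contDiffWithinAt)
    (fun x hx => ((hball hx).2.1.comp x
      (ha.contDiffAt.of_le (by norm_cast; omega))).contDiffWithinAt) ?_
    (fun x hx => (Prod.ext_iff.1 hx.2).1) ?_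
  · refine measure_mono_null ?_ key
    intro t ht
    simp only [LinearMap.toSpanSingleton_apply, mem_ofPred_eq, mem_compl_iff, not_not] at ht
    obtain ⟨⟨p, w⟩, hz, hp⟩ := ht
    exact ⟨(t, w), by simpa [a, ← hp] using hz, rfl⟩
  · intro x hx
    have h1 : HasFDerivAt ζ (fderiv ℝ ζ (a x)) (a x) :=
      ((hball hx).2.1.differentiableAt (by simpa using hn)).hasFDerivAt
    rw [(h1.comp x (ha' x)).fderiv]
    refine (ContinuousLinearMap.opNorm_comp_le _ _).trans ?_
    have := (hball hx).2.2.1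
    gcongr
  · intro x hx
    have hb := hball (hVb hx.1)
    have h1 : HasFDerivAt H (fderiv ℝ H (a x)) (a x) :=
      (hb.1.differentiableAt (by simp)).hasFDerivAt
    rw [(h1.comp x (ha' x)).fderiv]
    refine ContinuousLinearMap.ext fun y => ?_
    have h2 : A' y = y.1 • (v, (0 : W)) + ContinuousLinearMap.inr ℝ P W y.2 := by
      simp [A']
    have h3 : ζ (a x) (fderiv ℝ H (a x) (v, 0)) = 1 := by
      change (s (a x))⁻¹ * s (a x) = 1
      exact inv_mul_cancel₀ hb.2.2.2.1
    have h4 : ζ (a x) (fderiv ℝ H (a x) (ContinuousLinearMap.inr ℝ P W y.2)) = 0 :=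
      DFunLike.congr_fun (Prod.ext_iff.1 hx.2).2 y.2
    change ζ (a x) (fderiv ℝ H (a x) (A' y)) = y.1
    rw [h2, map_add, map_add, map_smul, map_smul, h3, h4]
    simp

/-- The parametric transversality theorem: if `0` is a regular value of `H` along `X`, then for
almost every parameter `p` it is a regular value of `H (p, ·)` along the slice of `X`. -/
theorem ae_surjective_fderiv_comp_inr (μ : Measure P) [μ.IsAddHaarMeasure] {n : ℕ}
    (hW : Module.finrank ℝ W ≤ n) (hn : n ≠ 0) {H : P × W → C} {X : Set (P × W)}
    (hH : ∀ z ∈ X, ContDiffAt ℝ (n + 1 : ℕ) H z) (hX : ∀ z ∈ X, H z = 0)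
    (hsurj : ∀ z ∈ X, Function.Surjective (fderiv ℝ H z)) :
    ∀ᵐ p ∂μ, ∀ w, (p, w) ∈ X →
      Function.Surjective ((fderiv ℝ H (p, w)).comp (ContinuousLinearMap.inr ℝ P W)) := by
  have : ProperSpace (P × W) := FiniteDimensional.proper_real _
  -- Stratification by rank, since the annihilator is smooth only along operators of constant rank.
  let B : ℕ → Set (P × W) := fun ρ => {z ∈ X |
    ¬ Function.Surjective ((fderiv ℝ H z).comp (ContinuousLinearMap.inr ℝ P W)) ∧
    Module.finrank ℝ ((fderiv ℝ H z).comp (ContinuousLinearMap.inr ℝ P W)).range = ρ}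
  have hB : ∀ ρ, μ (Prod.fst '' B ρ) = 0 := by
    intro ρ
    refine of_locally_of_sUnion (P := fun S => μ (Prod.fst '' S) = 0) (fun T hT h => ?_)
      fun z hz => ?_
    · rw [sUnion_eq_biUnion, image_iUnion₂]
      exact (measure_biUnion_null_iff hT).2 h
    · obtain ⟨V, hV, hV0⟩ := exists_nhds_measure_critical_eq_zero μ hW hn (hH z hz.1)
        (hsurj z hz.1) hz.2.1
      refine ⟨V, hV, measure_mono_null (image_mono ?_) hV0⟩
      exact fun y hy => ⟨hy.2, hX y hy.1.1, hy.1.2.2.trans hz.2.2.symm⟩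
  rw [ae_iff]
  refine measure_mono_null ?_ (measure_iUnion_null hB)
  intro p hp
  simp only [mem_ofPred_eq, not_forall] at hp
  obtain ⟨w, hw, hns⟩ := hp
  exact mem_iUnion.2 ⟨_, (p, w), ⟨hw, hns, rfl⟩, rfl⟩

end ParametricTransversality

/-! ### LICQ and Karush-Kuhn-Tucker multipliers -/

namespace ACOPF

variable {ι κ σ : Type*} [Fintype ι] [Fintype κ] [Fintype σ]

/-- Full row rank means that the column space is everything. -/
theorem LICQ_iff_surjective [DecidableEq ι] (h : (ι → ℝ) → (κ → ℝ)) (g : (ι → ℝ) → (σ → ℝ)) (x : ι → ℝ) :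
    LICQ h g x ↔ Function.Surjective fun d : ι → ℝ =>
      (fderiv ℝ h x d, fun j : activeSet g x => fderiv ℝ g x d j) := by
  classical
  set A := Matrix.fromRows (jacobian h x)
      ((jacobian g x).submatrix (fun j : activeSet g x => (j : σ)) id) with hA
  have hmul : ∀ d, A.mulVec d =
      Sum.elim (fderiv ℝ h x d) (fun j : activeSet g x => fderiv ℝ g x d j) := by
    intro d
    rw [hA, Matrix.fromRows_mulVec]
    have h1 : (jacobian h x).mulVec d = fderiv ℝ h x d := LinearMap.toMatrix'_mulVec _ _
    have h2 : (jacobian g x).mulVec d = fderiv ℝ g x d := LinearMap.toMatrix'_mulVec _ _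
    rw [h1, ← h2]
    rfl
  have hcard : Fintype.card κ + (activeSet g x).ncard =
      Module.finrank ℝ (κ ⊕ activeSet g x → ℝ) := by
    rw [Module.finrank_fintype_fun_eq_card, Fintype.card_sum, ← Nat.card_coe_set_eq,
      Nat.card_eq_fintype_card]
  have hrank : LICQ h g x ↔ Function.Surjective A.mulVecLin := by
    rw [LICQ, hcard, ← LinearMap.range_eq_top, Matrix.rank]
    exact ⟨Submodule.eq_top_of_finrank_eq, fun h => by rw [h, finrank_top]⟩
  rw [hrank]
  have hcomp : (fun d : ι → ℝ => (fderiv ℝ h x d, fun j : activeSet g x => fderiv ℝ g x d j)) =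
      Equiv.sumArrowEquivProdArrow κ (activeSet g x) ℝ ∘ A.mulVecLin := by
    funext d
    simp only [Function.comp_apply, Matrix.mulVecLin_apply, hmul]
    rfl
  rw [hcomp, EquivLike.comp_surjective]

theorem fderiv_lagrangian_apply {f : (ι → ℝ) → ℝ} {h : (ι → ℝ) → (κ → ℝ)}
    {g : (ι → ℝ) → (σ → ℝ)} {x : ι → ℝ} (hf : DifferentiableAt ℝ f x)
    (hh : DifferentiableAt ℝ h x) (hg : DifferentiableAt ℝ g x) (lam : κ → ℝ) (mu : σ → ℝ)
    (d : ι → ℝ) : fderiv ℝ (lagrangian f h g lam mu) x d =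
      fderiv ℝ f x d + lam ⬝ᵥ fderiv ℝ h x d + mu ⬝ᵥ fderiv ℝ g x d := by
  have h1 := (dotProductBilin ℝ ℝ lam).toContinuousLinearMap.hasFDerivAt.comp x hh.hasFDerivAt
  have h2 := (dotProductBilin ℝ ℝ mu).toContinuousLinearMap.hasFDerivAt.comp x hg.hasFDerivAt
  exact DFunLike.congr_fun ((hf.hasFDerivAt.add h1).add h2).fderiv d

theorem dotProduct_eq_sum_subtype {mu : σ → ℝ} {s : Set σ} [Fintype s] (hmu : ∀ j, j ∉ s → mu j = 0)
    (y : σ → ℝ) : mu ⬝ᵥ y = ∑ j : s, mu j * y j :=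
  (Fintype.sum_of_injective (Subtype.val : s → σ) Subtype.val_injective _ _
    (fun j hj => by rw [hmu j (by simpa using hj), zero_mul]) (fun _ => rfl)).symm

/-- The difference of two multiplier pairs annihilates the image of the derivatives of `h` and the
active `g`, which is everything by LICQ. -/
theorem IsKKTMultiplier.unique [DecidableEq ι] {f : (ι → ℝ) → ℝ} {h : (ι → ℝ) → (κ → ℝ)}
    {g : (ι → ℝ) → (σ → ℝ)} {x : ι → ℝ} (hf : DifferentiableAt ℝ f x)
    (hh : DifferentiableAt ℝ h x) (hg : DifferentiableAt ℝ g x) (hlicq : LICQ h g x)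
    {lam lam' : κ → ℝ} {mu mu' : σ → ℝ} (hm : IsKKTMultiplier f h g x lam mu)
    (hm' : IsKKTMultiplier f h g x lam' mu') : lam = lam' ∧ mu = mu' := by
  classical
  rw [LICQ_iff_surjective] at hlicq
  have key : ∀ (a : κ → ℝ) (b : activeSet g x → ℝ),
      (lam - lam') ⬝ᵥ a + ∑ j : activeSet g x, (mu - mu') j * b j = 0 := by
    intro a b
    obtain ⟨d, hd⟩ := hlicq (a, b)
    obtain ⟨rfl, rfl⟩ := Prod.ext_iff.1 hd
    have h1 := DFunLike.congr_fun hm.2.1 d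
    have h2 := DFunLike.congr_fun hm'.2.1 d
    rw [fderiv_lagrangian_apply hf hh hg] at h1 h2
    have h3 := dotProduct_eq_sum_subtype (mu := mu - mu') (s := activeSet g x)
      (fun j hj => by simp [hm.2.2 j hj, hm'.2.2 j hj]) (fderiv ℝ g x d)
    simp only [← h3, sub_dotProduct]
    simp only [_root_.zero_apply] at h1 h2
    linarith
  constructor
  · funext i
    have := key (Pi.single i 1) 0
    simpa [sub_eq_zero] using this
  · funext j
    by_cases hj : j ∈ activeSet g x
    · have := key 0 (Pi.single ⟨j, hj⟩ 1)
      simpa [Pi.single_apply, sub_eq_zero] using this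
    · rw [hm.2.2 j hj, hm'.2.2 j hj]

/-- Moving from `x` along a curve that decreases `G` in the direction `e` cannot decrease, to first
order, a function which is minimal at `x` among the points with `G = G x - t • e`, `t ≥ 0`. -/
theorem apply_neg_nonneg_of_forall_le {E F : Type*} [NormedAddCommGroup E] [NormedSpace ℝ E]
    [CompleteSpace E] [NormedAddCommGroup F] [NormedSpace ℝ F] [FiniteDimensional ℝ F]
    {f : E → ℝ} {G : E → F} {f' : E →L[ℝ] ℝ} {G' : E →L[ℝ] F} {x : E}
    (hf : HasFDerivAt f f' x) (hG : HasStrictFDerivAt G G' x) (hsurj : Function.Surjective G')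
    {c : F → ℝ} (hc : ∀ d, f' d = c (G' d)) {e : F}
    (hmin : ∀ᶠ y in 𝓝 x, ∀ t : ℝ, 0 ≤ t → G y = G x - t • e → f x ≤ f y) : 0 ≤ c (-e) := by
  have : CompleteSpace F := FiniteDimensional.complete ℝ F
  -- Along the affine slice `x + R s` the map `G` has identity derivative. Its local inverse `τ`
  -- there yields a curve with `G = G x - t • e` exactly, along which the one-sided derivative of
  -- `f` at 0 is nonnegative.
  obtain ⟨R, hR⟩ := G'.exists_rightInverse_of_surjective (LinearMap.range_eq_top.2 hsurj)
  have hx : HasStrictFDerivAt (fun s : F => x + R s) R 0 := R.hasStrictFDerivAt.const_add x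
  have hq : HasStrictFDerivAt (fun s => G (x + R s))
      ((ContinuousLinearEquiv.refl ℝ F : F ≃L[ℝ] F) : F →L[ℝ] F) 0 := by
    have h1 : HasStrictFDerivAt G G' (x + R 0) := by simpa using hG
    have := h1.comp (0 : F) hx
    rwa [hR] at this
  set τ := hq.localInverse _ _ _ with hτ
  have hτ0 : τ (G x) = 0 := by simpa using hq.localInverse_apply_image
  have hτ' : HasFDerivAt τ (ContinuousLinearMap.id ℝ F) (G x) := by
    simpa using hq.to_localInverse.hasFDerivAt
  have hr : ∀ᶠ y in 𝓝 (G x), G (x + R (τ y)) = y := by simpa using hq.eventually_right_inverse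
  have hline : HasFDerivAt (fun t : ℝ => G x - t • e)
      (-(ContinuousLinearMap.id ℝ ℝ).smulRight e) 0 :=
    ((hasFDerivAt_id (𝕜 := ℝ) (0 : ℝ)).smul_const e).const_sub (G x)
  have hτl : HasFDerivAt (fun t : ℝ => τ (G x - t • e))
      ((ContinuousLinearMap.id ℝ F).comp (-(ContinuousLinearMap.id ℝ ℝ).smulRight e)) 0 :=
    HasFDerivAt.comp (g := τ) (0 : ℝ) (by simpa using hτ') hline
  have hγ := (R.hasFDerivAt.comp (0 : ℝ) hτl).const_add x
  have hφ := HasFDerivAt.comp (g := f) (0 : ℝ) (by simpa [hτ0] using hf) hγ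
  have hmem : IsLocalMinOn (f ∘ fun t : ℝ => x + (R ∘ fun t : ℝ => τ (G x - t • e)) t)
      (Ici 0) 0 := by
    have h1 : ∀ᶠ t in 𝓝 (0 : ℝ), G (x + R (τ (G x - t • e))) = G x - t • e :=
      hline.continuousAt.eventually (by simpa using hr)
    have h2 := hγ.continuousAt.eventually (by simpa [hτ0] using hmin)
    filter_upwards [nhdsWithin_le_nhds h1, nhdsWithin_le_nhds h2, self_mem_nhdsWithin]
      with t ht1 ht2 ht3
    simpa [hτ0] using ht2 t ht3 ht1
  have := hmem.hasFDerivWithinAt_nonneg hφ.hasFDerivWithinAt (y := 1)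
    (mem_posTangentConeAt_of_segment_subset (by
      rw [zero_add, segment_eq_Icc zero_le_one]
      exact Icc_subset_Ici_self))
  have hRe : G' (R (-e)) = -e := DFunLike.congr_fun hR (-e)
  rw [← hRe, ← hc]
  simpa using this

/-- Lagrange multipliers for the active constraints taken as equalities. Relaxing one active
inequality at a time gives the sign. -/
theorem LICQ.existsUnique_isKKTMultiplier [DecidableEq ι] {f : (ι → ℝ) → ℝ} {h : (ι → ℝ) → (κ → ℝ)}
    {g : (ι → ℝ) → (σ → ℝ)} {x : ι → ℝ} (hlicq : LICQ h g x) (hf : ContDiffAt ℝ 1 f x)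
    (hh : ContDiffAt ℝ 1 h x) (hg : ContDiffAt ℝ 1 g x) (hx : x ∈ feasibleSet h g)
    (hmin : IsLocalMinOn f (feasibleSet h g) x) :
    ∃! m : (κ → ℝ) × (σ → ℝ), IsKKTMultiplier f h g x m.1 m.2 := by
  classical
  have hfd := hf.differentiableAt one_ne_zero
  have hhd := hh.differentiableAt one_ne_zero
  have hgd := hg.differentiableAt one_ne_zero
  suffices ∃ lam mu, IsKKTMultiplier f h g x lam mu by
    obtain ⟨lam, mu, hm⟩ := this
    exact ⟨(lam, mu), hm, fun m' hm' => Prod.ext_iff.2 (hm'.unique hfd hhd hgd hlicq hm)⟩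
  rw [LICQ_iff_surjective] at hlicq
  let ρ : (σ → ℝ) →L[ℝ] (activeSet g x → ℝ) :=
    ContinuousLinearMap.pi fun j => ContinuousLinearMap.proj (j : σ)
  let G : (ι → ℝ) → (κ → ℝ) × (activeSet g x → ℝ) := fun y => (h y, ρ (g y))
  let G' : (ι → ℝ) →L[ℝ] (κ → ℝ) × (activeSet g x → ℝ) :=
    (fderiv ℝ h x).prod (ρ.comp (fderiv ℝ g x))
  have hG : HasStrictFDerivAt G G' x :=
    (hh.hasStrictFDerivAt one_ne_zero).prodMk
      (ρ.hasStrictFDerivAt.comp x (hg.hasStrictFDerivAt one_ne_zero))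
  have hsurj : Function.Surjective G' := hlicq
  have hGx : G x = 0 := Prod.ext hx.1 (funext fun j => j.2)
  -- Inactive constraints stay strictly negative near `x`, so only the active ones restrict the
  -- minimization.
  have hlocal : ∀ᶠ y in 𝓝 x, (G y).1 = 0 → (G y).2 ≤ 0 → f x ≤ f y := by
    have h1 : ∀ᶠ y in 𝓝 x, y ∈ feasibleSet h g → f x ≤ f y := eventually_nhdsWithin_iff.1 hmin
    have h2 : ∀ᶠ y in 𝓝 x, ∀ j, j ∉ activeSet g x → g y j < 0 := by
      refine eventually_all.2 fun j => ?_
      by_cases hj : j ∈ activeSet g x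
      · exact Eventually.of_forall fun y h => absurd hj h
      · have hlt : g x j < 0 := lt_of_le_of_ne (hx.2 j) hj
        filter_upwards [(continuousAt_pi.1 hgd.continuousAt j).eventually_lt_const hlt]
          with y hy _ using hy
    filter_upwards [h1, h2] with y hy1 hy2 hy3 hy4
    refine hy1 ⟨hy3, fun j => ?_⟩
    by_cases hj : j ∈ activeSet g x
    · exact hy4 ⟨j, hj⟩
    · exact (hy2 j hj).le
  have hextr : IsLocalExtrOn f {y | G y = G x} x := by
    refine Or.inl ?_
    filter_upwards [nhdsWithin_le_nhds hlocal, self_mem_nhdsWithin] with y hy1 hy2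
    have hy3 : G y = 0 := hy2.trans hGx
    exact hy1 (by rw [hy3]; rfl) (by rw [hy3]; exact le_rfl)
  obtain ⟨Λ, Λ₀, hne, hΛ⟩ := hextr.exists_linear_map_of_hasStrictFDerivAt hG
    (hf.hasStrictFDerivAt one_ne_zero)
  -- Normality: with `Λ₀ = 0` the functional `Λ` would vanish on the range of `G'`, hence
  -- everywhere.
  have hΛ₀ : Λ₀ ≠ 0 := by
    rintro rfl
    refine hne (Prod.ext (LinearMap.ext fun v => ?_) rfl)
    obtain ⟨d, rfl⟩ := hsurj v
    simpa using hΛ d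
  let c : (κ → ℝ) × (activeSet g x → ℝ) →ₗ[ℝ] ℝ := (-Λ₀⁻¹) • Λ
  have hc : ∀ d, fderiv ℝ f x d = c (G' d) := by
    intro d
    have := hΛ d
    simp only [smul_eq_mul] at this
    simp only [c, LinearMap.smul_apply, smul_eq_mul]
    field_simp
    linarith
  have hsum : ∀ a b, c (a, b) = ∑ i, a i * c (Pi.single i 1, 0) +
      ∑ j, b j * c (0, Pi.single j 1) := by
    intro a b
    have h1 : (a, b) = LinearMap.inl ℝ _ _ a + LinearMap.inr ℝ _ _ b := by simp
    have h2 := LinearMap.pi_apply_eq_sum_univ (c ∘ₗ LinearMap.inl ℝ (κ → ℝ) _) a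
    have h3 := LinearMap.pi_apply_eq_sum_univ
      (c ∘ₗ LinearMap.inr ℝ (κ → ℝ) (activeSet g x → ℝ)) b
    rw [h1, map_add]
    simp only [LinearMap.comp_apply, smul_eq_mul, LinearMap.inl_apply, LinearMap.inr_apply] at h2 h3
    rw [LinearMap.inl_apply, LinearMap.inr_apply, h2, h3]
    congr! 5 <;> exact funext fun k => by simp [Pi.single_apply, eq_comm]
  have hmu : ∀ j, j ∉ activeSet g x →
      (fun j => if hj : j ∈ activeSet g x then -c (0, Pi.single ⟨j, hj⟩ 1) else 0) j = 0 :=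
    fun j hj => dif_neg hj
  refine ⟨fun i => -c (Pi.single i 1, 0),
    fun j => if hj : j ∈ activeSet g x then -c (0, Pi.single ⟨j, hj⟩ 1) else 0, ?_, ?_, hmu⟩
  · intro j
    by_cases hj : j ∈ activeSet g x
    · have := apply_neg_nonneg_of_forall_le hfd.hasFDerivAt hG hsurj hc
        (e := (0, Pi.single ⟨j, hj⟩ 1)) (by
          filter_upwards [hlocal] with y hy t ht hGy
          rw [hGx, zero_sub] at hGy
          refine hy (by rw [hGy]; simp) ?_
          rw [hGy]
          intro i
          have : (0 : ℝ) ≤ (Pi.single (⟨j, hj⟩ : activeSet g x) (1 : ℝ) : _ → ℝ) i := by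
            rw [Pi.single_apply]; split_ifs <;> simp
          simpa using mul_nonneg ht this)
      rw [map_neg] at this
      simpa [hj] using this
    · simp [hj]
  · ext1 d
    rw [fderiv_lagrangian_apply hfd hhd hgd, dotProduct_eq_sum_subtype hmu, hc]
    change c (fderiv ℝ h x d, fun j => fderiv ℝ g x d j) + _ + _ = 0
    rw [hsum]
    simp only [dotProduct, Subtype.coe_prop, dite_true, neg_mul, Finset.sum_neg_distrib]
    simp only [mul_comm (c _), Subtype.coe_eta]
    ring


/-! ### Load and voltage coordinates on the state space -/

variable {N I : ℕ} (net : Network N)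

theorem contDiff_voltage {n : WithTop ℕ∞} (k : Fin N) :
    ContDiff ℝ n fun x : State N => voltage x k := by
  have h (i : Fin 4 × Fin N) : ContDiff ℝ n fun x : State N => (x i : ℂ) :=
    Complex.ofRealCLM.contDiff.comp (contDiff_apply ℝ ℝ i)
  exact (h _).mul ((h _).mul contDiff_const).cexp

theorem Network.contDiff_injection {n : WithTop ℕ∞} (k : Fin N) :
    ContDiff ℝ n fun x : State N => net.injection x k := by
  have h : ContDiff ℝ n fun x : State N => net.admittance.mulVec (voltage x) k := by
    simp only [Matrix.mulVec, dotProduct]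
    exact ContDiff.sum fun l _ => contDiff_const.mul (contDiff_voltage l)
  exact (contDiff_voltage k).mul (Complex.conjCLE.contDiff.comp h)

theorem Network.contDiff_powerFlow {n : WithTop ℕ∞} (ξ : Load N) :
    ContDiff ℝ n (net.powerFlow ξ) := by
  refine contDiff_pi.2 ?_
  have hre k : ContDiff ℝ n fun x : State N => (net.injection x k).re :=
    Complex.reCLM.contDiff.comp (net.contDiff_injection k)
  have him k : ContDiff ℝ n fun x : State N => (net.injection x k).im :=
    Complex.imCLM.contDiff.comp (net.contDiff_injection k)
  rintro ⟨i, k⟩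
  fin_cases i
  · exact ((contDiff_apply ℝ ℝ _).sub contDiff_const).sub (hre k)
  · exact ((contDiff_apply ℝ ℝ _).sub contDiff_const).sub (him k)

/-- The magnitudes and angles of the nodal voltages. -/
def voltagePart (x : State N) : Load N :=
  fun i => ![x (2, i.2), x (3, i.2)] i.1

/-- The state with given nodal voltages and no generation. -/
def ofVoltage (w : Load N) : State N :=
  fun i => ![0, 0, w (0, i.2), w (1, i.2)] i.1

/-- The state with given loads and voltages that solves the power flow equations. -/
noncomputable def Network.solution (z : Load N × Load N) : State N :=
  fun i => ![z.1 (0, i.2) + (net.injection (ofVoltage z.2) i.2).re,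
    z.1 (1, i.2) + (net.injection (ofVoltage z.2) i.2).im, z.2 (0, i.2), z.2 (1, i.2)] i.1

theorem contDiff_ofVoltage {n : WithTop ℕ∞} : ContDiff ℝ n (ofVoltage (N := N)) := by
  refine contDiff_pi.2 ?_
  rintro ⟨i, k⟩
  fin_cases i
  exacts [contDiff_const, contDiff_const, contDiff_apply ℝ ℝ _, contDiff_apply ℝ ℝ _]

theorem contDiff_voltagePart {n : WithTop ℕ∞} : ContDiff ℝ n (voltagePart (N := N)) := by
  refine contDiff_pi.2 ?_
  rintro ⟨i, k⟩
  fin_cases i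
  exacts [contDiff_apply ℝ ℝ _, contDiff_apply ℝ ℝ _]

theorem Network.contDiff_solution {n : WithTop ℕ∞} : ContDiff ℝ n net.solution := by
  have hinj k : ContDiff ℝ n fun z : Load N × Load N => net.injection (ofVoltage z.2) k :=
    (net.contDiff_injection k).comp (contDiff_ofVoltage.comp contDiff_snd)
  have h1 (i : Fin 2 × Fin N) : ContDiff ℝ n fun z : Load N × Load N => z.1 i :=
    (contDiff_apply ℝ ℝ i).comp contDiff_fst
  have h2 (i : Fin 2 × Fin N) : ContDiff ℝ n fun z : Load N × Load N => z.2 i :=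
    (contDiff_apply ℝ ℝ i).comp contDiff_snd
  refine contDiff_pi.2 ?_
  rintro ⟨i, k⟩
  fin_cases i
  · exact (h1 _).add (Complex.reCLM.contDiff.comp (hinj k))
  · exact (h1 _).add (Complex.imCLM.contDiff.comp (hinj k))
  · exact h2 _
  · exact h2 _

theorem Network.injection_congr {x y : State N} (h2 : ∀ k, x (2, k) = y (2, k))
    (h3 : ∀ k, x (3, k) = y (3, k)) : net.injection x = net.injection y := by
  have : voltage x = voltage y := funext fun k => by simp only [voltage, h2, h3]
  funext k
  simp only [Network.injection, this]

theorem Network.powerFlow_solution (ξ : Load N) (z : Load N × Load N) :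
    net.powerFlow ξ (net.solution z) = z.1 - ξ := by
  have h : net.injection (net.solution z) = net.injection (ofVoltage z.2) :=
    net.injection_congr (fun _ => rfl) (fun _ => rfl)
  funext ⟨i, k⟩
  fin_cases i <;> simp [Network.powerFlow, h, Network.solution] <;> ring

theorem Network.solution_powerFlow (x : State N) :
    net.solution (net.powerFlow 0 x, voltagePart x) = x := by
  have h : net.injection (ofVoltage (voltagePart x)) = net.injection x :=
    net.injection_congr (fun _ => rfl) (fun _ => rfl)
  funext ⟨i, k⟩
  fin_cases i <;> simp [Network.powerFlow, h, Network.solution, voltagePart]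

theorem Network.voltagePart_solution (z : Load N × Load N) :
    voltagePart (net.solution z) = z.2 := by
  funext ⟨i, k⟩
  fin_cases i <;> rfl

theorem Network.powerFlow_eq_zero_iff {ξ : Load N} {x : State N} :
    net.powerFlow ξ x = 0 ↔ net.powerFlow 0 x = ξ := by
  rw [← net.solution_powerFlow x, net.powerFlow_solution, net.powerFlow_solution, sub_zero,
    sub_eq_zero]

/-- Differentiating `solution_powerFlow` provides a right inverse of the derivative. -/
theorem Network.surjective_fderiv_solution (z : Load N × Load N) :
    Function.Surjective (fderiv ℝ net.solution z) := by
  have hz : (net.powerFlow 0 (net.solution z), voltagePart (net.solution z)) = z := by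
    rw [net.powerFlow_solution, net.voltagePart_solution, sub_zero]
  have h1 : HasFDerivAt net.solution (fderiv ℝ net.solution z)
      (net.powerFlow 0 (net.solution z), voltagePart (net.solution z)) := by
    rw [hz]
    exact ((net.contDiff_solution (n := 1)).differentiable one_ne_zero z).hasFDerivAt
  have h2 := (((net.contDiff_powerFlow (n := 1) 0).prodMk contDiff_voltagePart).differentiable
    one_ne_zero (net.solution z)).hasFDerivAt
  have h3 := h1.comp (net.solution z) h2
  have h4 : net.solution ∘ (fun x => (net.powerFlow 0 x, voltagePart x)) = id :=
    funext net.solution_powerFlow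
  rw [h4] at h3
  have h5 := h3.unique (hasFDerivAt_id _)
  exact fun d => ⟨_, DFunLike.congr_fun h5 d⟩

theorem Network.fderiv_powerFlow_fderiv_solution (ξ : Load N) (z y : Load N × Load N) :
    fderiv ℝ (net.powerFlow ξ) (net.solution z) (fderiv ℝ net.solution z y) = y.1 := by
  have h1 := ((net.contDiff_solution (n := 1)).differentiable one_ne_zero z).hasFDerivAt
  have h2 := ((net.contDiff_powerFlow (n := 1) ξ).differentiable one_ne_zero
    (net.solution z)).hasFDerivAt
  have h3 := h2.comp z h1
  have h4 : net.powerFlow ξ ∘ net.solution = fun z => z.1 - ξ := funext (net.powerFlow_solution ξ)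
  rw [h4] at h3
  exact DFunLike.congr_fun (h3.unique (hasFDerivAt_fst.sub_const ξ)) y

/-! ### LICQ for the full problem -/

theorem Network.contDiffAt_equality {n : WithTop ℕ∞} {h : State N → (Fin I → ℝ)} {x : State N}
    (hh : ContDiffAt ℝ n h x) (ξ : Load N) : ContDiffAt ℝ n (net.equality h ξ) x := by
  refine contDiffAt_pi.2 ?_
  rintro (i | i)
  · exact (contDiff_apply ℝ ℝ i).contDiffAt.comp x (net.contDiff_powerFlow ξ).contDiffAt
  · exact (contDiff_apply ℝ ℝ i).contDiffAt.comp x hh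

theorem Network.fderiv_equality_apply {h : State N → (Fin I → ℝ)} {x : State N}
    (hh : DifferentiableAt ℝ h x) (ξ : Load N) (d : State N) :
    fderiv ℝ (net.equality h ξ) x d =
      Sum.elim (fderiv ℝ (net.powerFlow ξ) x d) (fderiv ℝ h x d) := by
  let e := (LinearEquiv.sumArrowLequivProdArrow (Fin 2 × Fin N) (Fin I) ℝ ℝ).symm
    |>.toContinuousLinearEquiv
  have h1 := ((net.contDiff_powerFlow (n := 1) ξ).differentiable one_ne_zero x).hasFDerivAt
  have h2 := e.hasFDerivAt.comp x (h1.prodMk hh.hasFDerivAt)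
  exact DFunLike.congr_fun h2.fderiv d

/-- In the coordinates (ξ, w) the stacked derivative is block triangular: the power flow rows see
only the load increment. That increment is fixed first, and the voltage increment then corrects the
rows of `h` and the active `g`. -/
theorem Network.LICQ_equality {J : ℕ} {h : State N → (Fin I → ℝ)} {g : State N → (Fin J → ℝ)}
    {z : Load N × Load N} (hh : DifferentiableAt ℝ h (net.solution z)) (ξ : Load N)
    (hsurj : Function.Surjective fun w : Load N =>
      (fderiv ℝ h (net.solution z) (fderiv ℝ net.solution z (0, w)),
        fun j : activeSet g (net.solution z) =>
          fderiv ℝ g (net.solution z) (fderiv ℝ net.solution z (0, w)) j)) :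
    LICQ (net.equality h ξ) g (net.solution z) := by
  rw [LICQ_iff_surjective]
  rintro ⟨a, b⟩
  set α : Load N := fun i => a (Sum.inl i) with hα
  set d₀ := fderiv ℝ net.solution z (α, 0)
  obtain ⟨w, hw⟩ := hsurj (fun i => a (Sum.inr i) - fderiv ℝ h (net.solution z) d₀ i,
    fun j => b j - fderiv ℝ g (net.solution z) d₀ j)
  obtain ⟨hw1, hw2⟩ := Prod.ext_iff.1 hw
  have hd : fderiv ℝ net.solution z (α, w) = d₀ + fderiv ℝ net.solution z (0, w) := by
    rw [← map_add]
    simp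
  refine ⟨fderiv ℝ net.solution z (α, w), Prod.ext ?_ (funext fun j => ?_)⟩
  · simp only [net.fderiv_equality_apply hh, net.fderiv_powerFlow_fderiv_solution]
    funext i
    rcases i with i | i
    · rfl
    · have := congrFun hw1 i
      simp only at this
      simp [hd, this]
  · have := congrFun hw2 j
    simp only at this
    simp [hd, this]

theorem Network.ae_LICQ_equality {J : ℕ} {h : State N → (Fin I → ℝ)} {g : State N → (Fin J → ℝ)}
    (hh : ∀ x ∈ feasibleSet h g, ContDiffAt ℝ (2 * N + 1 : ℕ) h x)
    (hg : ∀ x ∈ feasibleSet h g, ContDiffAt ℝ (2 * N + 1 : ℕ) g x)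
    (hlicq : ∀ x ∈ feasibleSet h g, LICQ h g x) :
    ∀ᵐ ξ : Load N, ∀ x ∈ feasibleSet (net.equality h ξ) g, LICQ (net.equality h ξ) g x := by
  classical
  let ρ : ∀ s : Set (Fin J), (Fin J → ℝ) →L[ℝ] (s → ℝ) := fun s =>
    ContinuousLinearMap.pi fun j => ContinuousLinearMap.proj (j : Fin J)
  -- Fixing the active set fixes the target space of the constraint map, as transversality requires.
  let X : Set (Fin J) → Set (Load N × Load N) := fun s =>
    {z | net.solution z ∈ feasibleSet h g ∧ activeSet g (net.solution z) = s}
  let G : ∀ s : Set (Fin J), State N → (Fin I → ℝ) × (s → ℝ) := fun s x => (h x, ρ s (g x))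
  let H : ∀ s : Set (Fin J), Load N × Load N → (Fin I → ℝ) × (s → ℝ) := fun s =>
    G s ∘ net.solution
  have hH : ∀ s, ∀ z ∈ X s, HasFDerivAt (H s)
      (((fderiv ℝ h (net.solution z)).prod ((ρ s).comp (fderiv ℝ g (net.solution z)))).comp
        (fderiv ℝ net.solution z)) z := by
    intro s z hz
    have h1 := ((net.contDiff_solution (n := 1)).differentiable one_ne_zero z).hasFDerivAt
    have h2 := ((hh _ hz.1).differentiableAt (by simp)).hasFDerivAt
    have h3 := ((hg _ hz.1).differentiableAt (by simp)).hasFDerivAt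
    have h4 : HasFDerivAt (G s) _ (net.solution z) :=
      h2.prodMk ((ρ s).hasFDerivAt.comp (net.solution z) h3)
    exact h4.comp z h1
  have hsurj : ∀ s, ∀ z ∈ X s, Function.Surjective (fderiv ℝ (H s) z) := by
    rintro s z ⟨hz, rfl⟩
    rw [(hH _ z ⟨hz, rfl⟩).fderiv]
    have h1 := Function.Surjective.comp ((LICQ_iff_surjective h g _).1 (hlicq _ hz))
      (net.surjective_fderiv_solution z)
    exact h1
  have hae : ∀ s, ∀ᵐ ξ : Load N, ∀ w, (ξ, w) ∈ X s → Function.Surjective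
      ((fderiv ℝ (H s) (ξ, w)).comp (ContinuousLinearMap.inr ℝ (Load N) (Load N))) := by
    intro s
    -- The transversality theorem needs n = 2N nonzero. For N = 0 the coordinate space is a point,
    -- so surjectivity of the full derivative already suffices.
    rcases Nat.eq_zero_or_pos N with rfl | hN
    · refine Eventually.of_forall fun ξ w hz c => ?_
      obtain ⟨d, rfl⟩ := hsurj s _ hz c
      exact ⟨0, congrArg (fderiv ℝ (H s) (ξ, w)) (Subsingleton.elim _ d)⟩
    · refine ae_surjective_fderiv_comp_inr volume (n := 2 * N)
        (by simp) (by omega) (fun z hz => ?_) (fun z hz => ?_) (hsurj s)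
      · have hs := (net.contDiff_solution (n := (2 * N + 1 : ℕ))).contDiffAt (x := z)
        exact ((hh _ hz.1).comp z hs).prodMk
          ((ρ s).contDiff.contDiffAt.comp z ((hg _ hz.1).comp z hs))
      · obtain ⟨hz, rfl⟩ := hz
        exact Prod.ext hz.1 (funext fun j => j.2)
  filter_upwards [ae_all_iff.2 hae] with ξ hξ x hx
  have hpf : net.powerFlow ξ x = 0 := funext fun i => congrFun hx.1 (Sum.inl i)
  have hx0 : x ∈ feasibleSet h g := ⟨funext fun i => congrFun hx.1 (Sum.inr i), hx.2⟩
  -- Balance at load ξ says exactly that the load coordinate of `x` is ξ.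
  obtain ⟨w, rfl⟩ : ∃ w, net.solution (ξ, w) = x :=
    ⟨voltagePart x, by rw [← net.powerFlow_eq_zero_iff.1 hpf, net.solution_powerFlow]⟩
  refine net.LICQ_equality ((hh _ hx0).differentiableAt (by simp)) ξ ?_
  have := hξ _ w ⟨hx0, rfl⟩
  rwa [(hH _ _ ⟨hx0, rfl⟩).fderiv] at this

end ACOPF

theorem proposition1 {N I J : ℕ} (net : ACOPF.Network N)
    (Ξ : Set (ACOPF.Load N)) (hΞ_open : IsOpen Ξ) (hΞ_nonempty : Ξ.Nonempty)
    (h : ACOPF.State N → (Fin I → ℝ)) (g : ACOPF.State N → (Fin J → ℝ))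
    (r : ℕ) (hr : 2 * N < r)
    (hh : ∀ x ∈ ACOPF.feasibleSet h g, ContDiffAt ℝ r h x)
    (hg : ∀ x ∈ ACOPF.feasibleSet h g, ContDiffAt ℝ r g x)
    (hfixed : ∀ x ∈ ACOPF.feasibleSet h g, ACOPF.LICQ h g x) :
    ∀ᵐ ξ : ACOPF.Load N ∂MeasureTheory.volume, ξ ∈ Ξ →
      (∀ x ∈ ACOPF.feasibleSet (net.equality h ξ) g, ACOPF.LICQ (net.equality h ξ) g x) ∧
      (∀ f : ACOPF.State N → ℝ, ContDiff ℝ 1 f →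
        ∀ x ∈ ACOPF.feasibleSet (net.equality h ξ) g,
          IsLocalMinOn f (ACOPF.feasibleSet (net.equality h ξ) g) x →
          ∃! m : ((Fin 2 × Fin N) ⊕ Fin I → ℝ) × (Fin J → ℝ),
            ACOPF.IsKKTMultiplier f (net.equality h ξ) g x m.1 m.2) := by
  have hle : ((2 * N + 1 : ℕ) : WithTop ℕ∞) ≤ r := by exact_mod_cast hr
  have h1 : (1 : WithTop ℕ∞) ≤ r := by
    have : 1 ≤ r := by omega
    exact_mod_cast this
  filter_upwards [net.ae_LICQ_equality (fun x hx => (hh x hx).of_le hle)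
    (fun x hx => (hg x hx).of_le hle) hfixed] with ξ hξ _
  refine ⟨hξ, fun f hf x hx hmin => ?_⟩
  have hx0 : x ∈ ACOPF.feasibleSet h g := ⟨funext fun i => congrFun hx.1 (Sum.inr i), hx.2⟩
  exact (hξ x hx).existsUnique_isKKTMultiplier hf.contDiffAt
    (net.contDiffAt_equality ((hh x hx0).of_le h1) ξ) ((hg x hx0).of_le h1) hx hmin
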